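/- Let $m,k,m_I,k_I\ge 1$ be integers and put $\tau_1=\lceil m/m_I\rceil\lceil k/k_I\rceil$. A master uses $n=\sum_{u=1}^c n_u$ workers grouped in $c\ge 1$ clusters, cluster $u$ having $n_u$ workers, rate $\lambda_u>0$ and shift $s_u\ge 0$, where cluster $1$ is the fastest ($\lambda_u\le\lambda_1$ for all $u$) and $\lambda_u s_u=t_m$ does not depend on $u$. Every worker has to compute $\tau_1$ tasks. Under the cluster-dependent additive service time model (model 2), all task times, over all workers and tasks, are independent, and each task time of a worker in cluster $u$ has the shifted exponential distribution with shift $s_u/(km)$ and rate $\lambda_u km$. In the KES scheme that tolerates $n_s$ stragglers, $0\le n_s<n$, the waiting time $T_{\mathrm{KES}}$ of the master is the first time at which $n-n_s$ workers have each completed all of their $\tau_1$ tasks, i.e. the $(n-n_s)$-th smallest of the $n$ total times of the workers. Then $T_{\mathrm{KES}}$ is integrable and $$\mathbb E[T_{\mathrm{KES}}]\ \ge\ \frac{s_1}{k_I m_I}+\Phi_I(n),$$ where $$\Phi_I(n)=\frac{(n-n_s)\binom{n}{n_s}}{\lambda_1 km\,(\tau_1-1)!}\sum_{j=0}^{n-n_s-1}(-1)^j\binom{n-n_s-1}{j}\sum_{\ell=0}^{(\tau_1-1)(n_s+j)}a_\ell(\tau_1,n_s+j)\,\frac{(\tau_1+\ell)!}{(n_s+j+1)^{\tau_1+\ell+1}}$$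 and $a_\ell(o,p)$ is the coefficient of $x^\ell$ in $\bigl(\sum_{i=0}^{o-1}x^i/i!\bigr)^p$. Moreover, for every real $\sigma$, the $(n-n_s)$-th order statistic of $n$ i.i.d. shifted Erlang variables with shape $\tau_1$, rate $\lambda_1 km$ and shift $\sigma$ is integrable with mean $\sigma+\Phi_I(n)$ (so $\Phi_I(n)$ itself is the mean for shift $0$), and for the shift $\sigma=\tau_1 s_1/(km)$ this mean is also a lower bound for $\mathbb E[T_{\mathrm{KES}}]$. -/

import Mathlib

open MeasureTheory ProbabilityTheory

noncomputable section

/-- Law of a shifted exponential variable with shift `s` and rate `r`, i.e. of `s + Y` with `Y`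
exponential of rate `r`: it has density `r * exp (-r * (x - s))` on `x > s`. -/
def shiftedExp (s r : ℝ) : Measure ℝ :=
  (expMeasure r).map (fun x => s + x)

/-- Law of a shifted Erlang variable with shape `a`, rate `r` and shift `s`, i.e. of `s + G` with
`G` Erlang (gamma with integer shape `a`) of rate `r`. -/
def shiftedErlang (a : ℕ) (r s : ℝ) : Measure ℝ :=
  (gammaMeasure (a : ℝ) r).map (fun x => s + x)

/-- The `d`-th order statistic (the `d`-th smallest value, counted with multiplicity) of a finite
family of reals, for `1 ≤ d ≤` size of the family: the first time `t` at which at least `d` of the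
values are at most `t`. -/
def orderStat {ι : Type*} [Fintype ι] (d : ℕ) (x : ι → ℝ) : ℝ :=
  sInf {t : ℝ | d ≤ Nat.card {i : ι // x i ≤ t}}

/-- The workers: the `i`-th worker of cluster `u`, where cluster `u` has `size u` workers. -/
abbrev Worker {c : ℕ} (size : Fin c → ℕ) : Type := (u : Fin c) × Fin (size u)

/-- The number `⌈m / m_I⌉ ⌈k / k_I⌉` of tasks sent to every worker. -/
def numTasks (m k mI kI : ℕ) : ℕ :=
  ⌈(m : ℝ) / (mI : ℝ)⌉₊ * ⌈(k : ℝ) / (kI : ℝ)⌉₊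

/-- Cluster-dependent additive service time model, for `τ` tasks per worker: `X w j` is the time
that worker `w` spends on its `j`-th task. All these times are independent, and the time of a worker
of cluster `u` is shifted exponential with shift `s u / (k m)` and rate `lam u * k * m`. -/
structure AdditiveServiceTime {c : ℕ} (size : Fin c → ℕ) (m k τ : ℕ) (s lam : Fin c → ℝ)
    {Ω : Type*} [MeasurableSpace Ω] (μ : Measure Ω)
    (X : Worker size → Fin τ → Ω → ℝ) : Prop where
  law : ∀ (w : Worker size) (j : Fin τ),
    HasLaw (X w j) (shiftedExp (s w.1 / ((k : ℝ) * m)) (lam w.1 * k * m)) μ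
  indep : iIndepFun (fun p : Worker size × Fin τ => X p.1 p.2) μ

/-- The time at which a worker has computed all of its `τ` tasks. -/
def workerTime {c : ℕ} {size : Fin c → ℕ} {τ : ℕ} {Ω : Type*}
    (X : Worker size → Fin τ → Ω → ℝ) (w : Worker size) (ω : Ω) : ℝ :=
  ∑ j, X w j ω

/-- The waiting time of the master for a scheme that tolerates `ns` stragglers: the first time at
which all but `ns` of the `∑ u, size u` workers have computed all of their tasks. -/
def waitingTimeKES {c : ℕ} {size : Fin c → ℕ} {τ : ℕ} {Ω : Type*} (ns : ℕ)
    (X : Worker size → Fin τ → Ω → ℝ) (ω : Ω) : ℝ :=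
  orderStat ((∑ u, size u) - ns) (fun w => workerTime X w ω)

/-- The coefficient of `x ^ l` in the expansion of `(∑ i < o, x ^ i / i!) ^ p`. -/
def expCoeff (o p l : ℕ) : ℝ :=
  ((∑ i ∈ Finset.range o,
    Polynomial.C (1 / (i.factorial : ℝ)) * (Polynomial.X : Polynomial ℝ) ^ i) ^ p).coeff l

/-- The alternating sum `Φ_I(n)`, for `n` workers, `ns < n` stragglers, `τ ≥ 1` tasks per worker and
rate `r`. -/
def PhiI (n ns τ : ℕ) (r : ℝ) : ℝ :=
  (((n - ns : ℕ) : ℝ) * (n.choose ns : ℝ)) / (r * ((τ - 1).factorial : ℝ)) *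
    ∑ j ∈ Finset.range (n - ns), (-1 : ℝ) ^ j * ((n - ns - 1).choose j : ℝ) *
      ∑ l ∈ Finset.range ((τ - 1) * (ns + j) + 1),
        expCoeff τ (ns + j) l * ((τ + l).factorial : ℝ) / ((ns : ℝ) + j + 1) ^ (τ + l + 1)

end

/-!
The order statistics of a finite family are monotone in the family, so their mean only decreases
when some of the variables are replaced by smaller ones. The total time of a worker of cluster `u`
is a shifted Erlang variable, namely `τ s_u / (k m) + G / (lam_u k m)` with `G` Erlang of rate `1`,
and it only decreases when `s_u` and `lam_u` are replaced by `s_1` and `lam_1`. It thus suffices to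
find the mean of an order statistic of i.i.d. Erlang variables. The probability that exactly `i` of
`n` i.i.d. variables with continuous distribution function `F` are at most `t` is the `i`-th
Bernstein polynomial of degree `n` at `F t`. The derivatives of these polynomials telescope, so the
`d`-th order statistic has the density `n * B (F x)` with respect to the common law, where `B` is
the `(d - 1)`-st Bernstein polynomial of degree `n - 1`. For an Erlang law, expanding the powers of
`F` and `1 - F` leaves finitely many gamma integrals, which sum to `Φ_I(n)`.
-/

open Set Filter Topology

section OrderStatistic

variable {ι : Type*} {d : ℕ}

lemma exists_le_and_le_card_of_le_card [Finite ι] (hd : 1 ≤ d) {x : ι → ℝ} {t : ℝ}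
    (ht : d ≤ Nat.card {i // x i ≤ t}) : ∃ i, x i ≤ t ∧ d ≤ Nat.card {j // x j ≤ x i} := by
  have : Nonempty {i // x i ≤ t} := (Nat.card_pos_iff.1 (hd.trans ht)).1
  obtain ⟨⟨i, hi⟩, hmax⟩ := Finite.exists_max fun i : {i // x i ≤ t} ↦ x i
  exact ⟨i, hi, ht.trans (Nat.card_mono (toFinite {j | x j ≤ x i}) fun j hj ↦ hmax ⟨j, hj⟩)⟩

variable [Fintype ι]

lemma exists_isLeast_setOf_le_card (hd : d ∈ Icc 1 (Fintype.card ι)) (x : ι → ℝ) :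
    ∃ i, IsLeast {t : ℝ | d ≤ Nat.card {j // x j ≤ t}} (x i) := by
  obtain ⟨M, hM⟩ := (finite_range x).bddAbove
  have hdM : d ≤ Nat.card {j // x j ≤ M} := by
    simpa [fun j ↦ hM ⟨j, rfl⟩] using hd.2
  obtain ⟨i, -, hi⟩ := exists_le_and_le_card_of_le_card hd.1 hdM
  have : Nonempty {i // d ≤ Nat.card {j // x j ≤ x i}} := ⟨i, hi⟩
  obtain ⟨⟨i, hi⟩, hmin⟩ := Finite.exists_min fun i : {i // d ≤ Nat.card {j // x j ≤ x i}} ↦ x i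
  refine ⟨i, hi, fun t ht ↦ ?_⟩
  obtain ⟨j, hjt, hj⟩ := exists_le_and_le_card_of_le_card hd.1 ht
  exact (hmin ⟨j, hj⟩).trans hjt

lemma exists_orderStat_eq (hd : d ∈ Icc 1 (Fintype.card ι)) (x : ι → ℝ) :
    ∃ i, orderStat d x = x i :=
  (exists_isLeast_setOf_le_card hd x).imp fun _ h ↦ h.csInf_eq

lemma orderStat_le_iff (hd : d ∈ Icc 1 (Fintype.card ι)) {x : ι → ℝ} {t : ℝ} :
    orderStat d x ≤ t ↔ d ≤ Nat.card {i // x i ≤ t} := by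
  obtain ⟨i, hi⟩ := exists_isLeast_setOf_le_card hd x
  rw [orderStat, hi.csInf_eq]
  exact ⟨fun h ↦ le_trans hi.1 (Nat.card_mono (toFinite {j | x j ≤ t}) fun j hj ↦ le_trans hj h),
    fun h ↦ hi.2 h⟩

lemma orderStat_mono (hd : d ∈ Icc 1 (Fintype.card ι)) :
    Monotone (orderStat d : (ι → ℝ) → ℝ) := fun x y hxy ↦
  (orderStat_le_iff hd).2 <| ((orderStat_le_iff hd).1 le_rfl).trans <|
    Nat.card_mono (toFinite {i | x i ≤ orderStat d y}) fun i hi ↦ (hxy i).trans hi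

lemma orderStat_const_add (hd : d ∈ Icc 1 (Fintype.card ι)) (σ : ℝ) (x : ι → ℝ) :
    orderStat d (fun i ↦ σ + x i) = σ + orderStat d x := by
  refine eq_of_forall_ge_iff fun t ↦ ?_
  simp_rw [← le_sub_iff_add_le', orderStat_le_iff hd, ← le_sub_iff_add_le']

lemma abs_orderStat_le_sum_abs (hd : d ∈ Icc 1 (Fintype.card ι)) (x : ι → ℝ) :
    |orderStat d x| ≤ ∑ i, |x i| := by
  obtain ⟨i, hi⟩ := exists_orderStat_eq hd x
  rw [hi]
  exact Finset.single_le_sum (f := fun i ↦ |x i|) (fun i _ ↦ abs_nonneg _) (Finset.mem_univ i)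

lemma setOf_filter_le_eq (s : Finset ι) (t : ℝ) :
    {x : ι → ℝ | Finset.univ.filter (x · ≤ t) = s} = univ.pi fun i ↦ {y | y ≤ t ↔ i ∈ s} := by
  ext x
  simp [Finset.ext_iff]

lemma measurableSet_filter_le_eq (s : Finset ι) (t : ℝ) :
    MeasurableSet {x : ι → ℝ | Finset.univ.filter (x · ≤ t) = s} := by
  rw [setOf_filter_le_eq]
  exact .univ_pi fun i ↦ measurableSet_Iic.iff (.const _)

lemma setOf_card_filter_le_eq (k : ℕ) (t : ℝ) :
    {x : ι → ℝ | (Finset.univ.filter (x · ≤ t)).card = k} =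
      ⋃ s ∈ Finset.powersetCard k Finset.univ, {x | Finset.univ.filter (x · ≤ t) = s} := by
  ext x
  simp

lemma measurableSet_card_filter_le_eq (k : ℕ) (t : ℝ) :
    MeasurableSet {x : ι → ℝ | (Finset.univ.filter (x · ≤ t)).card = k} := by
  rw [setOf_card_filter_le_eq]
  exact Finset.measurableSet_biUnion _ fun s _ ↦ measurableSet_filter_le_eq s t

lemma orderStat_preimage_Iic (hd : d ∈ Icc 1 (Fintype.card ι)) (t : ℝ) :
    (orderStat d : (ι → ℝ) → ℝ) ⁻¹' Iic t =
      ⋃ k ∈ Finset.Icc d (Fintype.card ι),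
        {x | (Finset.univ.filter (x · ≤ t)).card = k} := by
  ext x
  simp [orderStat_le_iff hd, Fintype.card_subtype, Finset.card_le_univ]

lemma measurable_orderStat (hd : d ∈ Icc 1 (Fintype.card ι)) :
    Measurable (orderStat d : (ι → ℝ) → ℝ) := by
  refine measurable_of_Iic fun t ↦ ?_
  rw [orderStat_preimage_Iic hd]
  exact Finset.measurableSet_biUnion _ fun k _ ↦ measurableSet_card_filter_le_eq k t

lemma integrable_orderStat_comp {Ω : Type*} [MeasurableSpace Ω] {μ : Measure Ω}
    (hd : d ∈ Icc 1 (Fintype.card ι)) {Y : ι → Ω → ℝ} (hY : ∀ i, Integrable (Y i) μ) :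
    Integrable (fun ω ↦ orderStat d fun i ↦ Y i ω) μ :=
  (integrable_finsetSum Finset.univ fun i _ ↦ (hY i).abs).mono'
    ((measurable_orderStat hd).comp_aemeasurable
      (aemeasurable_pi_lambda _ fun i ↦ (hY i).aemeasurable)).aestronglyMeasurable
    (.of_forall fun _ ↦ abs_orderStat_le_sum_abs hd _)

end OrderStatistic

section OrderStatisticLaw

variable {ι : Type*} [Fintype ι] {d : ℕ} (ν : Measure ℝ) [IsProbabilityMeasure ν]

lemma measureReal_pi_filter_le_eq (s : Finset ι) (t : ℝ) :
    (Measure.pi fun _ : ι ↦ ν).real {x | Finset.univ.filter (x · ≤ t) = s} =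
      cdf ν t ^ s.card * (1 - cdf ν t) ^ (Fintype.card ι - s.card) := by
  classical
  have hfactor (i : ι) : ν.real {y | y ≤ t ↔ i ∈ s} = if i ∈ s then cdf ν t else 1 - cdf ν t := by
    split_ifs with hi
    · simp only [hi, iff_true, cdf_eq_real, Iic_def]
    · simp only [hi, iff_false, cdf_eq_real, ← probReal_compl_eq_one_sub measurableSet_Iic]
      rfl
  rw [setOf_filter_le_eq, measureReal_def, Measure.pi_pi, ENNReal.toReal_prod]
  simp_rw [← measureReal_def, hfactor, Finset.prod_ite, Finset.prod_const, Finset.filter_not,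
    Finset.filter_univ_mem, ← Finset.compl_eq_univ_sdiff, Finset.card_compl]

lemma measureReal_pi_card_filter_le_eq (k : ℕ) (t : ℝ) :
    (Measure.pi fun _ : ι ↦ ν).real {x | (Finset.univ.filter (x · ≤ t)).card = k} =
      (bernsteinPolynomial ℝ (Fintype.card ι) k).eval (cdf ν t) := by
  have hprob (s) (hs : s ∈ Finset.powersetCard k (Finset.univ : Finset ι)) :
      (Measure.pi fun _ : ι ↦ ν).real {x | Finset.univ.filter (x · ≤ t) = s} =
        cdf ν t ^ k * (1 - cdf ν t) ^ (Fintype.card ι - k) := by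
    rw [measureReal_pi_filter_le_eq, (Finset.mem_powersetCard.1 hs).2]
  rw [setOf_card_filter_le_eq]
  refine (measureReal_biUnion_finset (pairwiseDisjoint_fiber _ _)
    fun s _ ↦ measurableSet_filter_le_eq s t).trans ((Finset.sum_congr rfl hprob).trans ?_)
  simp [bernsteinPolynomial, mul_assoc]

lemma measureReal_pi_orderStat_preimage_Iic (hd : d ∈ Icc 1 (Fintype.card ι)) (t : ℝ) :
    (Measure.pi fun _ : ι ↦ ν).real (orderStat d ⁻¹' Iic t) =
      (∑ k ∈ Finset.Icc d (Fintype.card ι), bernsteinPolynomial ℝ (Fintype.card ι) k).eval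
        (cdf ν t) := by
  rw [orderStat_preimage_Iic hd, Polynomial.eval_finsetSum]
  exact (measureReal_biUnion_finset (pairwiseDisjoint_fiber _ _)
    fun k _ ↦ measurableSet_card_filter_le_eq k t).trans
      (Finset.sum_congr rfl fun k _ ↦ measureReal_pi_card_filter_le_eq ν k t)

end OrderStatisticLaw

section ProbabilityIntegralTransform

variable (ν : Measure ℝ) [IsProbabilityMeasure ν] [NullSingletonClass ν]

lemma continuous_cdf : Continuous (cdf ν) := by
  refine continuous_iff_continuousAt.2 fun x ↦ ?_
  have hleft : Function.leftLim (cdf ν) x = cdf ν x := by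
    have h : (cdf ν).measure {x} = 0 := by rw [measure_cdf, measure_singleton]
    rw [StieltjesFunction.measure_singleton, ENNReal.ofReal_eq_zero, sub_nonpos] at h
    exact ((monotone_cdf ν).leftLim_le le_rfl).antisymm h
  exact (monotone_cdf ν).continuousAt_iff_leftLim_eq_rightLim.2
    (hleft.trans (StieltjesFunction.rightLim_eq _ x).symm)

lemma exists_cdf_preimage_Iic_eq {u : ℝ} (hu : u ∈ Ioo 0 1) :
    ∃ b, cdf ν b = u ∧ cdf ν ⁻¹' Iic u = Iic b := by
  obtain ⟨t, ht⟩ : u ∈ range (cdf ν) := mem_range_of_exists_le_of_exists_ge (continuous_cdf ν)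
    ((tendsto_cdf_atBot ν).eventually_le_const hu.1).exists
    ((tendsto_cdf_atTop ν).eventually_const_le hu.2).exists
  obtain ⟨M, hM⟩ := ((tendsto_cdf_atTop ν).eventually_const_lt hu.2).exists
  have hbdd : BddAbove (cdf ν ⁻¹' Iic u) :=
    ⟨M, fun x hx ↦ ((monotone_cdf ν).reflect_lt (lt_of_le_of_lt hx hM)).le⟩
  have hb := (isClosed_Iic.preimage (continuous_cdf ν)).isGreatest_csSup ⟨t, ht.le⟩ hbdd
  refine ⟨_, hb.1.antisymm (ht.symm.trans_le (monotone_cdf ν (hb.2 ht.le))), ?_⟩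
  exact Subset.antisymm (fun x hx ↦ hb.2 hx) fun x hx ↦ (monotone_cdf ν hx).trans hb.1

lemma measure_cdf_preimage_Iic {u : ℝ} (hu : u ∈ Icc 0 1) :
    ν (cdf ν ⁻¹' Iic u) = ENNReal.ofReal u := by
  have hIoo {v : ℝ} (hv : v ∈ Ioo 0 1) : ν (cdf ν ⁻¹' Iic v) = ENNReal.ofReal v := by
    obtain ⟨b, hb, hpre⟩ := exists_cdf_preimage_Iic_eq ν hv
    rw [hpre, ← ofReal_cdf, hb]
  rcases eq_or_lt_of_le hu.1 with rfl | hu0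
  · have hlim : Tendsto ENNReal.ofReal (𝓝[>] 0) (𝓝 (ENNReal.ofReal 0)) :=
      (ENNReal.continuous_ofReal.tendsto 0).mono_left nhdsWithin_le_nhds
    refine le_antisymm (ge_of_tendsto hlim ?_) (by simp)
    filter_upwards [Ioo_mem_nhdsGT zero_lt_one] with v hv
    exact (measure_mono (preimage_mono (Iic_subset_Iic.2 hv.1.le))).trans_eq (hIoo hv)
  rcases eq_or_lt_of_le hu.2 with rfl | hu1
  · have hF : cdf ν ⁻¹' Iic 1 = univ := eq_univ_of_forall fun x ↦ cdf_le_one ν x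
    rw [hF, measure_univ, ENNReal.ofReal_one]
  · exact hIoo ⟨hu0, hu1⟩

lemma Iic_inter_Icc {α : Type*} [Lattice α] (a b c : α) : Iic a ∩ Icc b c = Icc b (c ⊓ a) := by
  rw [← Ici_inter_Iic, inter_comm, inter_assoc, Iic_inter_Iic, Ici_inter_Iic]

lemma map_cdf : ν.map (cdf ν) = volume.restrict (Icc 0 1) := by
  refine Measure.ext_of_Iic _ _ fun u ↦ ?_
  rw [Measure.map_apply (monotone_cdf ν).measurable measurableSet_Iic,
    Measure.restrict_apply measurableSet_Iic, Iic_inter_Icc, Real.volume_Icc, sub_zero]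
  rcases lt_or_ge u 0 with hu | hu
  · have hF : cdf ν ⁻¹' Iic u = ∅ :=
      eq_empty_of_forall_notMem fun x hx ↦ (hu.trans_le (cdf_nonneg ν x)).not_ge hx
    rw [hF, measure_empty, ENNReal.ofReal_of_nonpos (min_le_of_right_le hu.le)]
  · have hF : cdf ν ⁻¹' Iic u = cdf ν ⁻¹' Iic (1 ⊓ u) := by
      ext x
      simp [cdf_le_one ν x]
    rw [hF, measure_cdf_preimage_Iic ν ⟨le_min zero_le_one hu, min_le_left 1 u⟩]

-- The two truncations differ by a `ν`-null set, on which `cdf ν` is constant.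
lemma setLIntegral_Iic_comp_cdf {g : ℝ → ENNReal} (hg : Measurable g) (t : ℝ) :
    ∫⁻ x in Iic t, g (cdf ν x) ∂ν = ∫⁻ u in Icc 0 (cdf ν t), g u := by
  have hae : Iic t =ᵐ[ν] cdf ν ⁻¹' Iic (cdf ν t) := by
    refine ae_eq_of_subset_of_measure_ge (fun x hx ↦ monotone_cdf ν hx) ?_
      measurableSet_Iic.nullMeasurableSet (measure_ne_top _ _)
    rw [measure_cdf_preimage_Iic ν ⟨cdf_nonneg ν t, cdf_le_one ν t⟩, ofReal_cdf]
  rw [setLIntegral_congr hae, ← setLIntegral_map measurableSet_Iic hg (monotone_cdf ν).measurable,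
    map_cdf, Measure.restrict_restrict measurableSet_Iic, Iic_inter_Icc,
    min_eq_right (cdf_le_one ν t)]

end ProbabilityIntegralTransform

section OrderStatisticDensity

/-- The density on `[0, 1]` of the `d`-th smallest of `n` independent uniform variables, i.e. the
density of the beta distribution with parameters `d` and `n - d + 1`, for `1 ≤ d ≤ n`. -/
noncomputable def uniformOrderStatPDF (n d : ℕ) : Polynomial ℝ :=
  n * bernsteinPolynomial ℝ (n - 1) (d - 1)

variable {n d : ℕ}

lemma uniformOrderStatPDF_eval_nonneg (n d : ℕ) {u : ℝ} (hu : u ∈ Icc 0 1) :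
    0 ≤ (uniformOrderStatPDF n d).eval u := by
  have h0 : 0 ≤ u := hu.1
  have h1 : 0 ≤ 1 - u := sub_nonneg.2 hu.2
  simp only [uniformOrderStatPDF, bernsteinPolynomial, Polynomial.eval_mul, Polynomial.eval_pow,
    Polynomial.eval_sub, Polynomial.eval_natCast, Polynomial.eval_X, Polynomial.eval_one]
  positivity

lemma derivative_sum_Icc_bernsteinPolynomial (hd : d ∈ Icc 1 n) :
    Polynomial.derivative (∑ k ∈ Finset.Icc d n, bernsteinPolynomial ℝ n k) =
      uniformOrderStatPDF n d := by
  have hderiv (k) (hk : k ∈ Finset.Ico d (n + 1)) :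
      Polynomial.derivative (bernsteinPolynomial ℝ n k) =
        -(uniformOrderStatPDF n (k + 1) - uniformOrderStatPDF n k) := by
    obtain ⟨k, rfl⟩ := Nat.exists_eq_add_of_le' (hd.1.trans (Finset.mem_Ico.1 hk).1)
    simp only [bernsteinPolynomial.derivative_succ, uniformOrderStatPDF, Nat.add_sub_cancel]
    ring
  have hlast : uniformOrderStatPDF n (n + 1) = 0 := by
    simp [uniformOrderStatPDF,
      bernsteinPolynomial.eq_zero_of_lt ℝ (Nat.sub_one_lt_of_le (hd.1.trans hd.2) le_rfl)]
  rw [Polynomial.derivative_sum, ← Finset.Ico_add_one_right_eq_Icc, Finset.sum_congr rfl hderiv,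
    Finset.sum_neg_distrib, Finset.sum_Ico_sub _ (hd.2.trans n.le_succ), hlast, zero_sub, neg_neg]

lemma eval_zero_sum_Icc_bernsteinPolynomial (hd : 1 ≤ d) (n : ℕ) :
    (∑ k ∈ Finset.Icc d n, bernsteinPolynomial ℝ n k).eval 0 = 0 := by
  rw [Polynomial.eval_finsetSum]
  refine Finset.sum_eq_zero fun k hk ↦ ?_
  have hk : k ≠ 0 := Nat.one_le_iff_ne_zero.1 (hd.trans (Finset.mem_Icc.1 hk).1)
  simp [bernsteinPolynomial.eval_at_0, hk]

lemma integral_uniformOrderStatPDF (hd : d ∈ Icc 1 n) (u : ℝ) :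
    ∫ v in (0)..u, (uniformOrderStatPDF n d).eval v =
      (∑ k ∈ Finset.Icc d n, bernsteinPolynomial ℝ n k).eval u := by
  rw [← derivative_sum_Icc_bernsteinPolynomial hd, intervalIntegral.integral_eq_sub_of_hasDerivAt
    (fun v _ ↦ Polynomial.hasDerivAt _ v) (Polynomial.continuous _).continuousOn.intervalIntegrable,
    eval_zero_sum_Icc_bernsteinPolynomial hd.1, sub_zero]

lemma setLIntegral_uniformOrderStatPDF (hd : d ∈ Icc 1 n) {u : ℝ} (hu : u ∈ Icc 0 1) :
    ∫⁻ v in Icc 0 u, ENNReal.ofReal ((uniformOrderStatPDF n d).eval v) =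
      ENNReal.ofReal ((∑ k ∈ Finset.Icc d n, bernsteinPolynomial ℝ n k).eval u) := by
  rw [← integral_uniformOrderStatPDF hd, intervalIntegral.integral_of_le hu.1,
    ← integral_Icc_eq_integral_Ioc, ofReal_integral_eq_lintegral_ofReal
      (Polynomial.continuous _).continuousOn.integrableOn_Icc]
  filter_upwards [ae_restrict_mem measurableSet_Icc] with v hv
  exact uniformOrderStatPDF_eval_nonneg n d ⟨hv.1, hv.2.trans hu.2⟩

variable {ι : Type*} [Fintype ι] (ν : Measure ℝ) [IsProbabilityMeasure ν] [NullSingletonClass ν]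

theorem map_orderStat_pi (hd : d ∈ Icc 1 (Fintype.card ι)) :
    (Measure.pi fun _ : ι ↦ ν).map (orderStat d) =
      ν.withDensity fun x ↦
        ENNReal.ofReal ((uniformOrderStatPDF (Fintype.card ι) d).eval (cdf ν x)) := by
  refine Measure.ext_of_Iic _ _ fun t ↦ ?_
  rw [Measure.map_apply (measurable_orderStat hd) measurableSet_Iic, ← ofReal_measureReal,
    measureReal_pi_orderStat_preimage_Iic ν hd, withDensity_apply _ measurableSet_Iic,
    ← setLIntegral_uniformOrderStatPDF hd ⟨cdf_nonneg ν t, cdf_le_one ν t⟩]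
  exact (setLIntegral_Iic_comp_cdf ν (Polynomial.continuous _).measurable.ennreal_ofReal t).symm

theorem integral_orderStat_pi (hd : d ∈ Icc 1 (Fintype.card ι)) :
    ∫ x, orderStat d x ∂(Measure.pi fun _ : ι ↦ ν) =
      ∫ x, x * (uniformOrderStatPDF (Fintype.card ι) d).eval (cdf ν x) ∂ν := by
  have hmeas : Measurable fun x ↦ (uniformOrderStatPDF (Fintype.card ι) d).eval (cdf ν x) :=
    (Polynomial.continuous _).measurable.comp (monotone_cdf ν).measurable
  refine (integral_map (f := id) (measurable_orderStat hd).aemeasurable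
    aestronglyMeasurable_id).symm.trans ?_
  rw [map_orderStat_pi ν hd, integral_withDensity_eq_integral_toReal_smul hmeas.ennreal_ofReal
      (.of_forall fun x ↦ ENNReal.ofReal_lt_top)]
  refine integral_congr_ae (.of_forall fun x ↦ ?_)
  simp only [ENNReal.toReal_ofReal (uniformOrderStatPDF_eval_nonneg _ d
    ⟨cdf_nonneg ν x, cdf_le_one ν x⟩), id, smul_eq_mul, mul_comm]

end OrderStatisticDensity

section OrderStatisticComparison

variable {ι : Type*} [Fintype ι] {d : ℕ} {ν : ι → Measure ℝ} [∀ i, IsProbabilityMeasure (ν i)]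

lemma integrable_orderStat_pi (hd : d ∈ Icc 1 (Fintype.card ι))
    (hν : ∀ i, Integrable id (ν i)) : Integrable (orderStat d) (Measure.pi ν) :=
  integrable_orderStat_comp hd fun i ↦ integrable_comp_eval (f := id) (hν i)

lemma integral_orderStat_pi_map (hd : d ∈ Icc 1 (Fintype.card ι)) {f : ι → ℝ → ℝ}
    (hf : ∀ i, AEMeasurable (f i) (ν i)) :
    ∫ x, orderStat d x ∂(Measure.pi fun i ↦ (ν i).map (f i)) =
      ∫ x, orderStat d (fun i ↦ f i (x i)) ∂(Measure.pi ν) := by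
  have (i : ι) : IsProbabilityMeasure ((ν i).map (f i)) := Measure.isProbabilityMeasure_map (hf i)
  rw [← Measure.pi_map_pi hf]
  refine integral_map (aemeasurable_pi_lambda _ fun i ↦ ?_)
    (measurable_orderStat hd).aestronglyMeasurable
  exact (hf i).comp_quasiMeasurePreserving (Measure.quasiMeasurePreserving_eval _ i)

lemma integral_orderStat_pi_map_const_add (hd : d ∈ Icc 1 (Fintype.card ι))
    (hν : ∀ i, Integrable id (ν i)) (σ : ℝ) :
    ∫ x, orderStat d x ∂(Measure.pi fun i ↦ (ν i).map (σ + ·)) =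
      σ + ∫ x, orderStat d x ∂(Measure.pi ν) := by
  rw [integral_orderStat_pi_map hd fun i ↦ (measurable_const_add σ).aemeasurable]
  simp_rw [orderStat_const_add hd]
  rw [integral_add (integrable_const σ) (integrable_orderStat_pi hd hν), integral_const,
    probReal_univ, one_smul]

lemma integral_orderStat_pi_map_mono (hd : d ∈ Icc 1 (Fintype.card ι)) {f g : ι → ℝ → ℝ}
    (hf : ∀ i, Integrable (f i) (ν i)) (hg : ∀ i, Integrable (g i) (ν i))
    (hfg : ∀ i, f i ≤ᵐ[ν i] g i) :
    ∫ x, orderStat d x ∂(Measure.pi fun i ↦ (ν i).map (f i)) ≤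
      ∫ x, orderStat d x ∂(Measure.pi fun i ↦ (ν i).map (g i)) := by
  rw [integral_orderStat_pi_map hd fun i ↦ (hf i).aemeasurable,
    integral_orderStat_pi_map hd fun i ↦ (hg i).aemeasurable]
  refine integral_mono_ae (integrable_orderStat_comp hd fun i ↦ integrable_comp_eval (hf i))
    (integrable_orderStat_comp hd fun i ↦ integrable_comp_eval (hg i)) ?_
  filter_upwards [Measure.ae_le_pi hfg] with x hx using orderStat_mono hd hx

end OrderStatisticComparison

section MomentGeneratingFunction

theorem ext_of_mgf_eventuallyEq {μ ν : Measure ℝ} [IsProbabilityMeasure μ]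
    [IsProbabilityMeasure ν] (hμ : 0 ∈ interior (integrableExpSet id μ))
    (h : mgf id μ =ᶠ[𝓝 0] mgf id ν) : μ = ν := by
  have hν : 0 ∈ interior (integrableExpSet id ν) := by
    rw [mem_interior_iff_mem_nhds] at hμ ⊢
    filter_upwards [hμ, h] with t hμt ht
    rw [integrableExpSet, mem_ofPred_eq, ← mgf_pos_iff, ← ht]
    exact mgf_pos hμt
  let strip (ρ : Measure ℝ) : Set ℂ := {z | z.re ∈ interior (integrableExpSet id ρ)}
  have hconvex (ρ : Measure ℝ) : Convex ℝ (strip ρ) :=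
    convex_integrableExpSet.interior.linear_preimage Complex.reLm
  have hreal : ∃ᶠ z in 𝓝[≠] (0 : ℂ), complexMGF id μ z = complexMGF id ν z := by
    have hcast : Tendsto ((↑) : ℝ → ℂ) (𝓝[≠] 0) (𝓝[≠] 0) :=
      Complex.continuous_ofReal.continuousWithinAt.tendsto_nhdsWithin fun _ ↦
        Complex.ofReal_ne_zero.2
    refine hcast.frequently (Eventually.frequently ?_)
    filter_upwards [nhdsWithin_le_nhds h] with t ht
    rw [complexMGF_ofReal, complexMGF_ofReal, ht]
  have heq : EqOn (complexMGF id μ) (complexMGF id ν) (strip μ ∩ strip ν) :=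
    AnalyticOnNhd.eqOn_of_preconnected_of_frequently_eq
      (analyticOnNhd_complexMGF.mono inter_subset_left)
      (analyticOnNhd_complexMGF.mono inter_subset_right)
      ((hconvex μ).inter (hconvex ν)).isPreconnected (by simpa [strip] using ⟨hμ, hν⟩) hreal
  refine Measure.ext_of_charFun (funext fun t ↦ ?_)
  rw [← complexMGF_id_mul_I, ← complexMGF_id_mul_I]
  exact heq (by simpa [strip] using ⟨hμ, hν⟩)

end MomentGeneratingFunction

section Gamma

variable {a r : ℝ}

instance (a r : ℝ) : NullSingletonClass (gammaMeasure a r) :=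
  inferInstanceAs (NullSingletonClass (volume.withDensity _))

lemma measurable_gammaPDF (a r : ℝ) : Measurable (gammaPDF a r) :=
  (measurable_gammaPDFReal a r).ennreal_ofReal

lemma ae_pos_gammaMeasure (a r : ℝ) : ∀ᵐ x ∂gammaMeasure a r, 0 < x := by
  have hne : ∀ᵐ x ∂gammaMeasure a r, x ≠ 0 := compl_mem_ae_iff.2 (measure_singleton 0)
  have hnonneg : ∀ᵐ x ∂gammaMeasure a r, 0 ≤ x := by
    rw [gammaMeasure, ae_withDensity_iff (measurable_gammaPDF a r)]
    exact .of_forall fun x hx ↦ not_lt.1 fun hlt ↦ hx (gammaPDF_of_neg hlt)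
  filter_upwards [hne, hnonneg] with x hne hnonneg using lt_of_le_of_ne' hnonneg hne

lemma integral_gammaMeasure (ha : 0 < a) (hr : 0 < r) (f : ℝ → ℝ) :
    ∫ x, f x ∂gammaMeasure a r =
      ∫ x in Ioi 0, r ^ a / Real.Gamma a * x ^ (a - 1) * Real.exp (-(r * x)) * f x := by
  have hpos : Ioi 0 =ᵐ[gammaMeasure a r] univ := eventuallyEq_univ.2 (ae_pos_gammaMeasure a r)
  rw [← setIntegral_univ, ← setIntegral_congr_set hpos, gammaMeasure,
    setIntegral_withDensity_eq_setIntegral_toReal_smul (measurable_gammaPDF a r)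
      (.of_forall fun x ↦ ENNReal.ofReal_lt_top) _ measurableSet_Ioi]
  refine setIntegral_congr_fun measurableSet_Ioi fun x (hx : 0 < x) ↦ ?_
  rw [gammaPDF, ENNReal.toReal_ofReal (gammaPDFReal_nonneg ha hr x), gammaPDFReal, if_pos hx.le,
    smul_eq_mul]

theorem integral_rpow_mul_exp_gammaMeasure {k t : ℝ} (ha : 0 < a) (hr : 0 < r) (hk : 0 < a + k)
    (ht : t < r) :
    ∫ x, x ^ k * Real.exp (t * x) ∂gammaMeasure a r =
      Real.Gamma (a + k) / Real.Gamma a * (r ^ a / (r - t) ^ (a + k)) := by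
  rw [integral_gammaMeasure ha hr]
  calc ∫ x in Ioi 0, r ^ a / Real.Gamma a * x ^ (a - 1) * Real.exp (-(r * x)) *
        (x ^ k * Real.exp (t * x))
      = ∫ x in Ioi 0, r ^ a / Real.Gamma a *
          (x ^ (a + k - 1) * Real.exp (-((r - t) * x))) := by
        refine setIntegral_congr_fun measurableSet_Ioi fun x (hx : 0 < x) ↦ ?_
        rw [show a + k - 1 = a - 1 + k by ring, Real.rpow_add hx,
          show -((r - t) * x) = -(r * x) + t * x by ring, Real.exp_add]
        ring
    _ = Real.Gamma (a + k) / Real.Gamma a * (r ^ a / (r - t) ^ (a + k)) := by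
        rw [integral_const_mul, Real.integral_rpow_mul_exp_neg_mul_Ioi hk (sub_pos.2 ht), one_div,
          Real.inv_rpow (sub_pos.2 ht).le]
        ring

lemma mgf_id_gammaMeasure {t : ℝ} (ha : 0 < a) (hr : 0 < r) (ht : t < r) :
    mgf id (gammaMeasure a r) t = (r / (r - t)) ^ a := by
  have h := integral_rpow_mul_exp_gammaMeasure (k := 0) ha hr (by simpa using ha) ht
  simpa [mgf, Real.div_rpow hr.le (sub_pos.2 ht).le, (Real.Gamma_pos_of_pos ha).ne'] using h

lemma Iio_subset_interior_integrableExpSet_gammaMeasure (ha : 0 < a) (hr : 0 < r) :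
    Iio r ⊆ interior (integrableExpSet id (gammaMeasure a r)) :=
  interior_maximal (fun t ht ↦ by
    have := isProbabilityMeasure_gammaMeasure ha hr
    rw [integrableExpSet, mem_ofPred_eq, ← mgf_pos_iff, mgf_id_gammaMeasure ha hr ht]
    exact Real.rpow_pos_of_pos (div_pos hr (sub_pos.2 ht)) a) isOpen_Iio

lemma integrable_pow_mul_exp_gammaMeasure {t : ℝ} (ha : 0 < a) (hr : 0 < r) (ht : t < r) (n : ℕ) :
    Integrable (fun x ↦ x ^ n * Real.exp (t * x)) (gammaMeasure a r) :=
  integrable_pow_mul_exp_of_mem_interior_integrableExpSet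
    (Iio_subset_interior_integrableExpSet_gammaMeasure ha hr ht) n

lemma integrable_id_gammaMeasure (ha : 0 < a) (hr : 0 < r) : Integrable id (gammaMeasure a r) :=
  integrable_of_mem_interior_integrableExpSet
    (Iio_subset_interior_integrableExpSet_gammaMeasure ha hr hr)

lemma eq_gammaMeasure_of_mgf_eventuallyEq {ν : Measure ℝ} [IsProbabilityMeasure ν] (ha : 0 < a)
    (hr : 0 < r) (h : ∀ᶠ t in 𝓝 0, mgf id ν t = (r / (r - t)) ^ a) : ν = gammaMeasure a r := by
  have := isProbabilityMeasure_gammaMeasure ha hr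
  refine (ext_of_mgf_eventuallyEq
    (Iio_subset_interior_integrableExpSet_gammaMeasure ha hr hr) ?_).symm
  filter_upwards [h, Iio_mem_nhds hr] with t ht htr
    using (mgf_id_gammaMeasure ha hr htr).trans ht.symm

theorem map_const_mul_gammaMeasure {b : ℝ} (ha : 0 < a) (hr : 0 < r) (hb : 0 < b) :
    (gammaMeasure a r).map (b * ·) = gammaMeasure a (r / b) := by
  have := isProbabilityMeasure_gammaMeasure ha hr
  have := Measure.isProbabilityMeasure_map (μ := gammaMeasure a r)
    (measurable_const_mul b).aemeasurable
  refine eq_gammaMeasure_of_mgf_eventuallyEq ha (div_pos hr hb) ?_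
  filter_upwards [Iio_mem_nhds (div_pos hr hb)] with t ht
  rw [mgf_id_map (measurable_const_mul b).aemeasurable]
  refine (mgf_const_mul (X := id) b).trans ?_
  rw [mgf_id_gammaMeasure ha hr ((lt_div_iff₀' hb).1 ht)]
  field_simp

theorem hasLaw_sum_gammaMeasure {Ω : Type*} [MeasurableSpace Ω] {μ : Measure Ω} {ι : Type*}
    [Fintype ι] [Nonempty ι] {X : ι → Ω → ℝ} {a : ι → ℝ} (ha : ∀ i, 0 < a i) (hr : 0 < r)
    (hX : ∀ i, HasLaw (X i) (gammaMeasure (a i) r) μ) (hindep : iIndepFun X μ) :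
    HasLaw (fun ω ↦ ∑ i, X i ω) (gammaMeasure (∑ i, a i) r) μ := by
  have := hindep.isProbabilityMeasure
  have hmeas : AEMeasurable (fun ω ↦ ∑ i, X i ω) μ :=
    Finset.aemeasurable_fun_sum _ fun i _ ↦ (hX i).aemeasurable
  have := Measure.isProbabilityMeasure_map hmeas
  refine ⟨hmeas, eq_gammaMeasure_of_mgf_eventuallyEq
    (Finset.sum_pos (fun i _ ↦ ha i) Finset.univ_nonempty) hr ?_⟩
  filter_upwards [Iio_mem_nhds hr] with t ht
  have hmgf (i : ι) : mgf (X i) μ t = (r / (r - t)) ^ a i := by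
    rw [← mgf_id_map (hX i).aemeasurable, (hX i).map_eq, mgf_id_gammaMeasure (ha i) hr ht]
  rw [mgf_id_map hmeas, ← Finset.sum_fn, hindep.mgf_sum₀ fun i ↦ (hX i).aemeasurable,
    Finset.prod_congr rfl fun i _ ↦ hmgf i, Real.rpow_sum_of_pos (div_pos hr (sub_pos.2 ht))]

end Gamma

section Erlang

variable {a : ℕ} {r : ℝ}

/-- The tail `P(G > y)` of an Erlang variable `G` of shape `a` and rate `1`, for `y ≥ 0`. -/
noncomputable def erlangTail (a : ℕ) (y : ℝ) : ℝ :=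
  Real.exp (-y) * ∑ i ∈ Finset.range a, y ^ i / i.factorial

lemma erlangTail_zero (ha : a ≠ 0) : erlangTail a 0 = 1 := by
  obtain ⟨a, rfl⟩ := Nat.exists_eq_add_one_of_ne_zero ha
  simp [erlangTail, Finset.sum_range_succ']

lemma hasDerivAt_erlangTail (a : ℕ) (y : ℝ) :
    HasDerivAt (erlangTail (a + 1)) (-(y ^ a / a.factorial * Real.exp (-y))) y := by
  have hexp : HasDerivAt (fun y : ℝ ↦ Real.exp (-y)) (-Real.exp (-y)) y := by
    simpa using (hasDerivAt_neg y).exp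
  induction a with
  | zero =>
    have htail : erlangTail (0 + 1) = fun y ↦ Real.exp (-y) := by
      funext y
      simp [erlangTail]
    rw [htail]
    exact hexp.congr_deriv (by simp)
  | succ a ih =>
    have htail : erlangTail (a + 1 + 1) =
        fun y ↦ erlangTail (a + 1) y + Real.exp (-y) * (y ^ (a + 1) / (a + 1).factorial) := by
      funext y
      rw [erlangTail, Finset.sum_range_succ, mul_add, erlangTail]
    rw [htail]
    refine (ih.fun_add (hexp.fun_mul ((hasDerivAt_pow (a + 1) y).div_const _))).congr_deriv ?_
    rw [Nat.factorial_succ, Nat.add_sub_cancel]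
    push_cast
    field_simp
    ring

lemma hasDerivAt_neg_erlangTail_const_mul (ha : a ≠ 0) (r x : ℝ) :
    HasDerivAt (fun x ↦ -erlangTail a (r * x))
      (r ^ a / (a - 1).factorial * x ^ (a - 1) * Real.exp (-(r * x))) x := by
  obtain ⟨a, rfl⟩ := Nat.exists_eq_add_one_of_ne_zero ha
  refine (((hasDerivAt_erlangTail a (r * x)).comp x
    ((hasDerivAt_id x).const_mul r)).fun_neg).congr_deriv ?_
  rw [Nat.add_sub_cancel]
  ring

lemma gamma_natCast (ha : a ≠ 0) : Real.Gamma a = (a - 1).factorial := by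
  obtain ⟨a, rfl⟩ := Nat.exists_eq_add_one_of_ne_zero ha
  rw [Nat.cast_add_one, Real.Gamma_nat_eq_factorial, Nat.add_sub_cancel]

theorem cdf_gammaMeasure_natCast (ha : a ≠ 0) (hr : 0 < r) {x : ℝ} (hx : 0 ≤ x) :
    cdf (gammaMeasure a r) x = 1 - erlangTail a (r * x) := by
  have ha0 : (0 : ℝ) < a := by positivity
  have := isProbabilityMeasure_gammaMeasure ha0 hr
  calc cdf (gammaMeasure a r) x
      = ∫ y, (Iic x).indicator 1 y ∂gammaMeasure a r := by
        rw [cdf_eq_real, integral_indicator_one measurableSet_Iic]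
    _ = ∫ y in Ioi 0, (Iic x).indicator
          (fun y ↦ r ^ a / (a - 1).factorial * y ^ (a - 1) * Real.exp (-(r * y))) y := by
        rw [integral_gammaMeasure ha0 hr]
        refine setIntegral_congr_fun measurableSet_Ioi fun y _ ↦ ?_
        simp only [indicator, Pi.one_apply, mul_ite, mul_one, mul_zero, gamma_natCast ha,
          ← Nat.cast_pred (Nat.pos_of_ne_zero ha), Real.rpow_natCast]
    _ = ∫ y in (0)..x, r ^ a / (a - 1).factorial * y ^ (a - 1) * Real.exp (-(r * y)) := by
        rw [setIntegral_indicator measurableSet_Iic, Ioi_inter_Iic,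
          intervalIntegral.integral_of_le hx]
    _ = 1 - erlangTail a (r * x) := by
        rw [intervalIntegral.integral_eq_sub_of_hasDerivAt
          (fun y _ ↦ hasDerivAt_neg_erlangTail_const_mul ha r y)
          (Continuous.intervalIntegrable (by fun_prop) 0 x), mul_zero, erlangTail_zero ha]
        ring

theorem integral_pow_mul_exp_gammaMeasure_natCast {t : ℝ} (ha : a ≠ 0) (hr : 0 < r) (ht : t < r)
    (n : ℕ) :
    ∫ x, x ^ n * Real.exp (t * x) ∂gammaMeasure a r =
      (a + n - 1).factorial / (a - 1).factorial * (r ^ a / (r - t) ^ (a + n)) := by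
  have h := integral_rpow_mul_exp_gammaMeasure (a := a) (k := n) (by positivity) hr
    (by positivity) ht
  simpa only [← Nat.cast_add, Real.rpow_natCast, gamma_natCast ha,
    gamma_natCast (Nat.add_eq_zero_iff.not.2 fun h ↦ ha h.1)] using h

lemma erlangTail_pow (a p : ℕ) (y : ℝ) :
    erlangTail a y ^ p =
      Real.exp (-(p * y)) * ∑ l ∈ Finset.range ((a - 1) * p + 1), expCoeff a p l * y ^ l := by
  set Q : Polynomial ℝ := ∑ i ∈ Finset.range a,
    Polynomial.C (1 / (i.factorial : ℝ)) * (Polynomial.X : Polynomial ℝ) ^ i with hQ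
  have hQdeg : Q.natDegree ≤ a - 1 :=
    Polynomial.natDegree_sum_le_of_forall_le _ _ fun i hi ↦
      (Polynomial.natDegree_C_mul_X_pow_le _ _).trans (Nat.le_sub_one_of_lt (Finset.mem_range.1 hi))
  have hQpow : (Q ^ p).natDegree < (a - 1) * p + 1 :=
    Nat.lt_succ_of_le (Polynomial.natDegree_pow_le_of_le p hQdeg |>.trans_eq (mul_comm _ _))
  have hQeval : Q.eval y = ∑ i ∈ Finset.range a, y ^ i / i.factorial := by
    simp [hQ, Polynomial.eval_finsetSum, div_eq_inv_mul]
  calc erlangTail a y ^ p = Real.exp (-(p * y)) * (Q ^ p).eval y := by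
        rw [erlangTail, mul_pow, ← Real.exp_nat_mul, mul_neg, Polynomial.eval_pow, hQeval]
    _ = _ := by rw [Polynomial.eval_eq_sum_range' hQpow]; rfl

end Erlang

section ErlangOrderStatistic

variable {a : ℕ} {r : ℝ}

lemma mul_erlangTail_pow (a p : ℕ) (r x : ℝ) :
    x * erlangTail a (r * x) ^ p =
      ∑ l ∈ Finset.range ((a - 1) * p + 1),
        expCoeff a p l * r ^ l * (x ^ (l + 1) * Real.exp (-(p * r) * x)) := by
  rw [erlangTail_pow, Finset.mul_sum, Finset.mul_sum]
  refine Finset.sum_congr rfl fun l _ ↦ ?_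
  rw [neg_mul, mul_assoc (p : ℝ)]
  ring

lemma integrable_mul_erlangTail_pow (ha : a ≠ 0) (hr : 0 < r) (p : ℕ) :
    Integrable (fun x ↦ x * erlangTail a (r * x) ^ p) (gammaMeasure a r) := by
  have ht : -(p * r) < r := (neg_nonpos.2 (by positivity)).trans_lt hr
  simp_rw [mul_erlangTail_pow]
  exact integrable_finsetSum _ fun l _ ↦
    (integrable_pow_mul_exp_gammaMeasure (by positivity) hr ht (l + 1)).const_mul _

lemma integral_mul_erlangTail_pow (ha : a ≠ 0) (hr : 0 < r) (p : ℕ) :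
    ∫ x, x * erlangTail a (r * x) ^ p ∂gammaMeasure a r =
      1 / (r * (a - 1).factorial) * ∑ l ∈ Finset.range ((a - 1) * p + 1),
        expCoeff a p l * (a + l).factorial / (p + 1) ^ (a + l + 1) := by
  have ht : -(p * r) < r := (neg_nonpos.2 (by positivity)).trans_lt hr
  simp_rw [mul_erlangTail_pow]
  rw [integral_finsetSum _ fun l _ ↦
    (integrable_pow_mul_exp_gammaMeasure (by positivity) hr ht (l + 1)).const_mul _, Finset.mul_sum]
  refine Finset.sum_congr rfl fun l _ ↦ ?_
  rw [integral_const_mul, integral_pow_mul_exp_gammaMeasure_natCast ha hr ht,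
    show r - -(p * r) = (p + 1) * r by ring, ← add_assoc, Nat.add_sub_cancel, mul_pow]
  field_simp
  ring

lemma uniformOrderStatPDF_sub_eval_one_sub {n k : ℕ} (hk : k < n) (x : ℝ) :
    (uniformOrderStatPDF n (n - k)).eval (1 - x) =
      (n - k : ℕ) * n.choose k *
        ∑ j ∈ Finset.range (n - k), (-1) ^ j * (n - k - 1).choose j * x ^ (k + j) := by
  obtain ⟨d, rfl⟩ := Nat.exists_eq_add_of_lt hk
  have hsub : k + d + 1 - k = d + 1 := by lia
  have hchoose : (k + d + 1) * (k + d).choose d = (d + 1) * (k + d + 1).choose k := by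
    rw [Nat.add_one_mul_choose_eq, mul_comm, ← Nat.choose_symm_of_eq_add (a := d + 1) (b := k)]
    lia
  have hbinom : (1 - x) ^ d = ∑ j ∈ Finset.range (d + 1), (-1) ^ j * d.choose j * x ^ j := by
    rw [sub_eq_neg_add, add_pow]
    exact Finset.sum_congr rfl fun j _ ↦ by rw [neg_pow, one_pow]; ring
  rw [hsub, ← Nat.cast_mul, ← hchoose]
  simp only [uniformOrderStatPDF, bernsteinPolynomial, Nat.add_sub_cancel, Polynomial.eval_mul,
    Polynomial.eval_pow, Polynomial.eval_sub, Polynomial.eval_natCast, Polynomial.eval_X,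
    Polynomial.eval_one, hbinom, sub_sub_cancel, pow_add, Nat.cast_mul, Finset.mul_sum,
    Finset.sum_mul]
  exact Finset.sum_congr rfl fun j _ ↦ by ring

variable {ι : Type*} [Fintype ι] {ns : ℕ}

theorem integral_orderStat_pi_gammaMeasure (hns : ns < Fintype.card ι) (ha : a ≠ 0) (hr : 0 < r) :
    ∫ x, orderStat (Fintype.card ι - ns) x ∂(Measure.pi fun _ : ι ↦ gammaMeasure a r) =
      PhiI (Fintype.card ι) ns a r := by
  have := isProbabilityMeasure_gammaMeasure (a := a) (by positivity) hr
  set n := Fintype.card ι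
  calc ∫ x, orderStat (n - ns) x ∂(Measure.pi fun _ : ι ↦ gammaMeasure a r)
      = ∫ x, x * (uniformOrderStatPDF n (n - ns)).eval (1 - erlangTail a (r * x))
          ∂gammaMeasure a r := by
        rw [integral_orderStat_pi _ ⟨Nat.sub_pos_of_lt hns, Nat.sub_le n ns⟩]
        refine integral_congr_ae ?_
        filter_upwards [ae_pos_gammaMeasure a r] with x hx
        rw [cdf_gammaMeasure_natCast ha hr hx.le]
    _ = ∫ x, ∑ j ∈ Finset.range (n - ns), ((n - ns : ℕ) * n.choose ns) *
          ((-1) ^ j * (n - ns - 1).choose j) * (x * erlangTail a (r * x) ^ (ns + j))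
          ∂gammaMeasure a r := by
        simp_rw [uniformOrderStatPDF_sub_eval_one_sub hns, Finset.mul_sum]
        congr! 3
        ring
    _ = PhiI n ns a r := by
        rw [integral_finsetSum _ fun j _ ↦
          (integrable_mul_erlangTail_pow ha hr (ns + j)).const_mul _, PhiI, Finset.mul_sum]
        refine Finset.sum_congr rfl fun j _ ↦ ?_
        rw [integral_const_mul, integral_mul_erlangTail_pow ha hr, Nat.cast_add]
        ring

theorem integral_orderStat_pi_shiftedErlang (hns : ns < Fintype.card ι) (ha : a ≠ 0) (hr : 0 < r)
    (σ : ℝ) :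
    ∫ x, orderStat (Fintype.card ι - ns) x ∂(Measure.pi fun _ : ι ↦ shiftedErlang a r σ) =
      σ + PhiI (Fintype.card ι) ns a r := by
  have := isProbabilityMeasure_gammaMeasure (a := a) (by positivity) hr
  rw [← integral_orderStat_pi_gammaMeasure hns ha hr]
  exact integral_orderStat_pi_map_const_add ⟨Nat.sub_pos_of_lt hns, Nat.sub_le _ _⟩
    (fun _ ↦ integrable_id_gammaMeasure (by positivity) hr) σ

lemma isProbabilityMeasure_shiftedErlang (ha : a ≠ 0) (hr : 0 < r) (σ : ℝ) :
    IsProbabilityMeasure (shiftedErlang a r σ) :=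
  have := isProbabilityMeasure_gammaMeasure (a := a) (by positivity) hr
  Measure.isProbabilityMeasure_map (measurable_const_add σ).aemeasurable

lemma integrable_id_shiftedErlang (ha : a ≠ 0) (hr : 0 < r) (σ : ℝ) :
    Integrable id (shiftedErlang a r σ) := by
  have := isProbabilityMeasure_gammaMeasure (a := a) (by positivity) hr
  rw [shiftedErlang, integrable_map_measure aestronglyMeasurable_id
    (measurable_const_add σ).aemeasurable]
  exact (integrable_const σ).add (integrable_id_gammaMeasure (by positivity) hr)

lemma shiftedErlang_eq_map_gammaMeasure_one (ha : a ≠ 0) (hr : 0 < r) (σ : ℝ) :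
    shiftedErlang a r σ = (gammaMeasure a 1).map (fun x ↦ σ + r⁻¹ * x) := by
  rw [shiftedErlang, ← one_div_one_div r, ← map_const_mul_gammaMeasure (by positivity) one_pos
    (one_div_pos.2 hr), Measure.map_map (measurable_const_add σ) (measurable_const_mul _)]
  simp only [one_div, inv_inv, Function.comp_def]

theorem integrable_orderStat_pi_shiftedErlang {d : ℕ} {r : ι → ℝ}
    (hd : d ∈ Icc 1 (Fintype.card ι)) (ha : a ≠ 0) (hr : ∀ i, 0 < r i) (σ : ι → ℝ) :
    Integrable (orderStat d) (Measure.pi fun i ↦ shiftedErlang a (r i) (σ i)) :=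
  have := fun i ↦ isProbabilityMeasure_shiftedErlang ha (hr i) (σ i)
  integrable_orderStat_pi hd fun i ↦ integrable_id_shiftedErlang ha (hr i) (σ i)

-- All the variables are affine images of Erlang variables of rate `1`, which couples them.
theorem integral_orderStat_pi_shiftedErlang_mono {d : ℕ} {r r' σ σ' : ι → ℝ}
    (hd : d ∈ Icc 1 (Fintype.card ι)) (ha : a ≠ 0) (hr' : ∀ i, 0 < r' i) (hrr' : ∀ i, r' i ≤ r i)
    (hσ : ∀ i, σ i ≤ σ' i) :
    ∫ x, orderStat d x ∂(Measure.pi fun i ↦ shiftedErlang a (r i) (σ i)) ≤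
      ∫ x, orderStat d x ∂(Measure.pi fun i ↦ shiftedErlang a (r' i) (σ' i)) := by
  have := isProbabilityMeasure_gammaMeasure (a := a) (by positivity) one_pos
  have hr (i : ι) : 0 < r i := (hr' i).trans_le (hrr' i)
  have hint (σ b : ℝ) : Integrable (fun x ↦ σ + b * x) (gammaMeasure a 1) :=
    (integrable_const σ).add ((integrable_id_gammaMeasure (by positivity) one_pos).const_mul b)
  simp_rw [fun i ↦ shiftedErlang_eq_map_gammaMeasure_one ha (hr i) (σ i),
    fun i ↦ shiftedErlang_eq_map_gammaMeasure_one ha (hr' i) (σ' i)]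
  refine integral_orderStat_pi_map_mono hd (fun i ↦ hint _ _) (fun i ↦ hint _ _) fun i ↦ ?_
  filter_upwards [ae_pos_gammaMeasure a 1] with x hx
  exact add_le_add (hσ i) (mul_le_mul_of_nonneg_right (inv_anti₀ (hr' i) (hrr' i)) hx.le)

end ErlangOrderStatistic

section ServiceTime

variable {Ω : Type*} [MeasurableSpace Ω] {μ : Measure Ω}

lemma iIndepFun_row {ι κ 𝓧 : Type*} [Countable ι] [Countable κ] [MeasurableSpace 𝓧]
    {X : ι → κ → Ω → 𝓧} (hX : ∀ i j, AEMeasurable (X i j) μ)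
    (h : iIndepFun (fun p : ι × κ ↦ X p.1 p.2) μ) : iIndepFun (fun i ω j ↦ X i j ω) μ := by
  have := h.isProbabilityMeasure
  have (i : ι) (j : κ) : IsProbabilityMeasure (μ.map (X i j)) :=
    Measure.isProbabilityMeasure_map (hX i j)
  have hrow (i : ι) : μ.map (fun ω j ↦ X i j ω) = Measure.infinitePi fun j ↦ μ.map (X i j) :=
    (h.precomp (Prod.mk_right_injective i)).map_fun_eq_infinitePi_map₀' (hX i)
  have hjoint := h.map_fun_eq_infinitePi_map₀' fun p : ι × κ ↦ hX p.1 p.2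
  rw [iIndepFun_iff_map_fun_eq_infinitePi_map₀' fun i ↦ aemeasurable_pi_lambda _ (hX i)]
  simp_rw [hrow]
  rw [← Measure.infinitePi_map_curry (fun i j ↦ μ.map (X i j)), ← hjoint,
    AEMeasurable.map_map_of_aemeasurable (by fun_prop)
      (aemeasurable_pi_lambda _ fun p : ι × κ ↦ hX p.1 p.2)]
  rfl

theorem hasLaw_sum_shiftedExp {ι : Type*} [Fintype ι] [Nonempty ι] {X : ι → Ω → ℝ} {s r : ℝ}
    (hr : 0 < r) (hX : ∀ i, HasLaw (X i) (shiftedExp s r) μ) (hindep : iIndepFun X μ) :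
    HasLaw (fun ω ↦ ∑ i, X i ω) (shiftedErlang (Fintype.card ι) r (Fintype.card ι * s)) μ := by
  have hexp (i : ι) : HasLaw (fun ω ↦ -s + X i ω) (gammaMeasure 1 r) μ := by
    refine HasLaw.fun_comp ⟨by fun_prop, ?_⟩ (hX i)
    rw [shiftedExp, Measure.map_map (by fun_prop) (by fun_prop)]
    simp [Function.comp_def, expMeasure]
  have herlang := hasLaw_sum_gammaMeasure (fun _ ↦ one_pos) hr hexp
    (hindep.comp (fun _ x ↦ -s + x) fun _ ↦ by fun_prop)
  have hshift : HasLaw (fun x ↦ Fintype.card ι * s + x)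
      (shiftedErlang (Fintype.card ι) r (Fintype.card ι * s))
      (gammaMeasure (∑ _ : ι, 1) r) := ⟨by fun_prop, by simp [shiftedErlang]⟩
  refine (hshift.fun_comp herlang).congr (.of_forall fun ω ↦ ?_)
  simp [Finset.sum_add_distrib]

lemma card_worker {c : ℕ} (size : Fin c → ℕ) : Fintype.card (Worker size) = ∑ u, size u := by
  simp

variable {c m k τ : ℕ} {size : Fin c → ℕ} {s lam : Fin c → ℝ} {X : Worker size → Fin τ → Ω → ℝ}

namespace AdditiveServiceTime

lemma hasLaw_workerTime (hX : AdditiveServiceTime size m k τ s lam μ X) (hm : m ≠ 0) (hk : k ≠ 0)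
    (hτ : τ ≠ 0) (w : Worker size) (hlam : 0 < lam w.1) :
    HasLaw (workerTime X w)
      (shiftedErlang τ (lam w.1 * k * m) (τ * (s w.1 / (k * m)))) μ := by
  have : NeZero τ := ⟨hτ⟩
  have hlaw := hasLaw_sum_shiftedExp (by positivity) (hX.law w)
    (hX.indep.precomp (g := fun j ↦ (w, j)) (Prod.mk_right_injective w))
  rwa [Fintype.card_fin] at hlaw

lemma iIndepFun_workerTime (hX : AdditiveServiceTime size m k τ s lam μ X) :
    iIndepFun (workerTime X) μ := by
  have hmeas (w : Worker size) (j : Fin τ) := (hX.law w j).aemeasurable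
  exact (iIndepFun_row hmeas hX.indep).comp₀ (fun _ x ↦ ∑ j, x j)
    (fun w ↦ aemeasurable_pi_lambda _ (hmeas w)) fun _ ↦ Measurable.aemeasurable (by fun_prop)

lemma hasLaw_workerTimes (hX : AdditiveServiceTime size m k τ s lam μ X) (hm : m ≠ 0)
    (hk : k ≠ 0) (hτ : τ ≠ 0) (hlam : ∀ u, 0 < lam u) :
    HasLaw (fun ω w ↦ workerTime X w ω)
      (Measure.pi fun w ↦ shiftedErlang τ (lam w.1 * k * m) (τ * (s w.1 / (k * m)))) μ :=
  hX.iIndepFun_workerTime.hasLaw_pi fun w ↦ hX.hasLaw_workerTime hm hk hτ w (hlam w.1)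

variable {ns : ℕ}

lemma integrable_orderStat_workerTimes (hX : AdditiveServiceTime size m k τ s lam μ X)
    (hm : m ≠ 0) (hk : k ≠ 0) (hτ : τ ≠ 0) (hlam : ∀ u, 0 < lam u) (hns : ns < ∑ u, size u) :
    Integrable (orderStat (∑ u, size u - ns)) (μ.map fun ω w ↦ workerTime X w ω) := by
  rw [(hX.hasLaw_workerTimes hm hk hτ hlam).map_eq]
  refine integrable_orderStat_pi_shiftedErlang ?_ hτ (fun w ↦ ?_) _
  · rw [card_worker]
    exact ⟨Nat.sub_pos_of_lt hns, Nat.sub_le _ _⟩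
  · have := hlam w.1
    positivity

theorem integrable_waitingTimeKES (hX : AdditiveServiceTime size m k τ s lam μ X) (hm : m ≠ 0)
    (hk : k ≠ 0) (hτ : τ ≠ 0) (hlam : ∀ u, 0 < lam u) (hns : ns < ∑ u, size u) :
    Integrable (waitingTimeKES ns X) μ :=
  (hX.integrable_orderStat_workerTimes hm hk hτ hlam hns).comp_aemeasurable
    (hX.hasLaw_workerTimes hm hk hτ hlam).aemeasurable

theorem shift_add_PhiI_le_integral_waitingTimeKES
    (hX : AdditiveServiceTime size m k τ s lam μ X) (hm : m ≠ 0) (hk : k ≠ 0) (hτ : τ ≠ 0)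
    (hlam : ∀ u, 0 < lam u) (hns : ns < ∑ u, size u) {s₀ lam₀ : ℝ} (hs₀ : ∀ u, s₀ ≤ s u)
    (hlam₀ : ∀ u, lam u ≤ lam₀) :
    τ * (s₀ / (k * m)) + PhiI (∑ u, size u) ns τ (lam₀ * k * m) ≤
      ∫ ω, waitingTimeKES ns X ω ∂μ := by
  have hlaw := hX.hasLaw_workerTimes hm hk hτ hlam
  obtain ⟨w⟩ : Nonempty (Worker size) := Fintype.card_pos_iff.1 (card_worker size ▸ by lia)
  have hlam₀_pos : 0 < lam₀ := (hlam w.1).trans_le (hlam₀ w.1)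
  calc τ * (s₀ / (k * m)) + PhiI (∑ u, size u) ns τ (lam₀ * k * m)
      = ∫ x, orderStat (∑ u, size u - ns) x
          ∂(Measure.pi fun _ : Worker size ↦
            shiftedErlang τ (lam₀ * k * m) (τ * (s₀ / (k * m)))) := by
        rw [← card_worker size, integral_orderStat_pi_shiftedErlang (by rwa [card_worker]) hτ
          (by positivity)]
    _ ≤ ∫ x, orderStat (∑ u, size u - ns) x ∂(Measure.pi fun w : Worker size ↦
          shiftedErlang τ (lam w.1 * k * m) (τ * (s w.1 / (k * m)))) := by
        refine integral_orderStat_pi_shiftedErlang_mono ?_ hτ (fun w ↦ ?_) (fun w ↦ ?_) fun w ↦ ?_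
        · rw [card_worker]
          exact ⟨Nat.sub_pos_of_lt hns, Nat.sub_le _ _⟩
        · have := hlam w.1
          positivity
        · gcongr
          exact hlam₀ w.1
        · gcongr
          exact hs₀ w.1
    _ = ∫ ω, waitingTimeKES ns X ω ∂μ := by
        rw [← hlaw.map_eq]
        exact integral_map hlaw.aemeasurable
          (hX.integrable_orderStat_workerTimes hm hk hτ hlam hns).aestronglyMeasurable

end AdditiveServiceTime

lemma numTasks_ne_zero {m k mI kI : ℕ} (hm : m ≠ 0) (hk : k ≠ 0) (hmI : mI ≠ 0) (hkI : kI ≠ 0) :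
    numTasks m k mI kI ≠ 0 :=
  mul_ne_zero (Nat.ceil_pos.2 (by positivity)).ne' (Nat.ceil_pos.2 (by positivity)).ne'

lemma div_le_numTasks_mul_div {m k : ℕ} (hm : m ≠ 0) (hk : k ≠ 0) (mI kI : ℕ) {s : ℝ}
    (hs : 0 ≤ s) : s / (kI * mI) ≤ numTasks m k mI kI * (s / (k * m)) := by
  have hceil : (m : ℝ) / mI * (k / kI) ≤ numTasks m k mI kI := by
    rw [numTasks, Nat.cast_mul]
    gcongr <;> exact Nat.le_ceil _
  calc s / (kI * mI) = (m : ℝ) / mI * (k / kI) * (s / (k * m)) := by field_simp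
    _ ≤ numTasks m k mI kI * (s / (k * m)) := by gcongr

end ServiceTime

theorem corollary2_general {c : ℕ} [NeZero c] (size : Fin c → ℕ) (m k mI kI n ns : ℕ)
    (hm : 1 ≤ m) (hk : 1 ≤ k) (hmI : 1 ≤ mI) (hkI : 1 ≤ kI)
    (hn : n = ∑ u, size u) (hns : ns < n)
    (s lam : Fin c → ℝ)
    (hs : 0 ≤ s 0) (hlam : ∀ u, 0 < lam u)
    (hfast : ∀ u, lam u ≤ lam 0) (hshift : ∀ u, s 0 ≤ s u)
    {Ω : Type*} [MeasurableSpace Ω] (μ : Measure Ω)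
    (X : Worker size → Fin (numTasks m k mI kI) → Ω → ℝ)
    (hX : AdditiveServiceTime size m k (numTasks m k mI kI) s lam μ X) :
    Integrable (waitingTimeKES ns X) μ ∧
    s 0 / ((kI : ℝ) * mI) + PhiI n ns (numTasks m k mI kI) (lam 0 * k * m)
      ≤ ∫ ω, waitingTimeKES ns X ω ∂μ ∧
    ((∀ σ : ℝ,
      Integrable (fun x : Fin n → ℝ => orderStat (n - ns) x)
        (Measure.pi fun _ : Fin n =>
          shiftedErlang (numTasks m k mI kI) (lam 0 * k * m) σ) ∧
      ∫ x : Fin n → ℝ, orderStat (n - ns) x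
        ∂(Measure.pi fun _ : Fin n =>
          shiftedErlang (numTasks m k mI kI) (lam 0 * k * m) σ)
        = σ + PhiI n ns (numTasks m k mI kI) (lam 0 * k * m)) ∧
    ∫ x : Fin n → ℝ, orderStat (n - ns) x
        ∂(Measure.pi fun _ : Fin n =>
          shiftedErlang (numTasks m k mI kI) (lam 0 * k * m)
            (numTasks m k mI kI * (s 0 / ((k : ℝ) * m))))
      ≤ ∫ ω, waitingTimeKES ns X ω ∂μ) := by
  have hm₀ := Nat.one_le_iff_ne_zero.1 hm
  have hk₀ := Nat.one_le_iff_ne_zero.1 hk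
  have hτ : numTasks m k mI kI ≠ 0 :=
    numTasks_ne_zero hm₀ hk₀ (Nat.one_le_iff_ne_zero.1 hmI) (Nat.one_le_iff_ne_zero.1 hkI)
  have hr : 0 < lam 0 * k * m := by
    have := hlam 0
    positivity
  have hmean (σ : ℝ) := integral_orderStat_pi_shiftedErlang (ι := Fin n)
    (by rwa [Fintype.card_fin]) hτ hr σ
  rw [Fintype.card_fin] at hmean
  subst hn
  have hbound := hX.shift_add_PhiI_le_integral_waitingTimeKES hm₀ hk₀ hτ hlam hns hshift hfast
  refine ⟨hX.integrable_waitingTimeKES hm₀ hk₀ hτ hlam hns, ?_, fun σ ↦ ⟨?_, hmean σ⟩, ?_⟩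
  · exact (add_le_add_left (div_le_numTasks_mul_div hm₀ hk₀ mI kI hs) _).trans hbound
  · refine integrable_orderStat_pi_shiftedErlang ?_ hτ (fun _ ↦ hr) _
    rw [Fintype.card_fin]
    exact ⟨Nat.sub_pos_of_lt hns, Nat.sub_le _ _⟩
  · exact (hmean _).trans_le hbound

theorem corollary2 {c : ℕ} [NeZero c] (size : Fin c → ℕ) (m k mI kI n ns : ℕ)
    (hm : 1 ≤ m) (hk : 1 ≤ k) (hmI : 1 ≤ mI) (hkI : 1 ≤ kI)
    (hn : n = ∑ u, size u) (hns : ns < n)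
    (s lam : Fin c → ℝ) (tm : ℝ)
    (hs : ∀ u, 0 ≤ s u) (hlam : ∀ u, 0 < lam u)
    (hfast : ∀ u, lam u ≤ lam 0) (htm : ∀ u, lam u * s u = tm)
    {Ω : Type*} [MeasurableSpace Ω] (μ : Measure Ω) [IsProbabilityMeasure μ]
    (X : Worker size → Fin (numTasks m k mI kI) → Ω → ℝ)
    (hX : AdditiveServiceTime size m k (numTasks m k mI kI) s lam μ X) :
    Integrable (waitingTimeKES ns X) μ ∧
    s 0 / ((kI : ℝ) * mI) + PhiI n ns (numTasks m k mI kI) (lam 0 * k * m)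
      ≤ ∫ ω, waitingTimeKES ns X ω ∂μ ∧
    ((∀ σ : ℝ,
      Integrable (fun x : Fin n → ℝ => orderStat (n - ns) x)
        (Measure.pi fun _ : Fin n =>
          shiftedErlang (numTasks m k mI kI) (lam 0 * k * m) σ) ∧
      ∫ x : Fin n → ℝ, orderStat (n - ns) x
        ∂(Measure.pi fun _ : Fin n =>
          shiftedErlang (numTasks m k mI kI) (lam 0 * k * m) σ)
        = σ + PhiI n ns (numTasks m k mI kI) (lam 0 * k * m)) ∧
    ∫ x : Fin n → ℝ, orderStat (n - ns) x
        ∂(Measure.pi fun _ : Fin n =>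
          shiftedErlang (numTasks m k mI kI) (lam 0 * k * m)
            (numTasks m k mI kI * (s 0 / ((k : ℝ) * m))))
      ≤ ∫ ω, waitingTimeKES ns X ω ∂μ) := by
  refine corollary2_general size m k mI kI n ns hm hk hmI hkI hn hns s lam (hs 0) hlam hfast
    (fun u ↦ le_of_mul_le_mul_left ?_ (hlam 0)) μ X hX
  exact (htm 0).trans_le ((htm u).ge.trans (mul_le_mul_of_nonneg_right (hfast u) (hs u)))
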